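/- **Theorem (Generalized fractional inverse inequality).** Let $n\ge 1$ and let $\Omega\subset\mathbb{R}^n$ be a bounded polygonal domain, i.e. a nonempty, connected, bounded open set whose boundary is a finite union of convex polytopes. A mesh $\mathscr{T}_h$ of $\Omega$ is a finite set of nondegenerate closed $n$-simplices with pairwise disjoint interiors such that $\overline{\Omega}=\bigcup_{T\in\mathscr{T}_h}T$ (for instance a conforming triangulation of $\overline\Omega$); its mesh size is $h:=\max_{T\in\mathscr{T}_h}\operatorname{diam}(T)$. The mesh is called shape-regular with parameter $\sigma$ (relative to the global mesh size $h$) if every $T\in\mathscr{T}_h$ contains a ball of diameter $\rho>0$ with $h\le\sigma\rho$. Let $m\in\mathbb{N}$, $m\ge1$, let $0<s<1$ and $1\le p<\infty$ satisfy $sp<1$, and let $\sigma\in\mathbb{R}$. Then there is a constant $C>0$, depending only on $n,\Omega,\sigma,m,s,p$, such that for every mesh $\mathscr{T}_h$ of $\Omega$ that is shape-regular with parameter $\sigma$, of mesh size $h$, and for every continuous $v:\Omega\to\mathbb{R}$ that on $T\cap\Omega$ agrees with a polynomial of total degree at most $m$ for every $T\in\mathscr{T}_h$, $$[v]_{W^{s,p}(\Omega)}:=\left(\int_\Omega\int_\Omega\frac{|v(x)-v(y)|^p}{|x-y|^{n+sp}}\,dx\,dy\right)^{1/p}\le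 C\,h^{-s}\,\|v\|_{L^p(\Omega)} .$$ In particular, the constant $C$ is independent of $h$ and $v$. -/

import Mathlib

open MeasureTheory
open scoped ENNReal

noncomputable section

namespace FracInverse

/-- A bounded polygonal (polyhedral) domain of `ℝⁿ`: a nonempty, connected, bounded open set whose
boundary is a finite union of convex polytopes (convex hulls of finite sets of points). -/
structure IsPolygonalDomain {n : ℕ} (Ω : Set (EuclideanSpace ℝ (Fin n))) : Prop where
  isOpen : IsOpen Ω
  isConnected : IsConnected Ω
  isBounded : Bornology.IsBounded Ω
  frontier_eq : ∃ F : Finset (Finset (EuclideanSpace ℝ (Fin n))),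
    frontier Ω = ⋃ P ∈ F, convexHull ℝ (P : Set (EuclideanSpace ℝ (Fin n)))

/-- The closed region occupied by a (nondegenerate) `n`-simplex of `ℝⁿ`. -/
def cell {n : ℕ} (T : Affine.Simplex ℝ (EuclideanSpace ℝ (Fin n)) n) :
    Set (EuclideanSpace ℝ (Fin n)) :=
  convexHull ℝ (Set.range T.points)

/-- A mesh of `Ω`: finitely many nondegenerate closed `n`-simplices with pairwise disjoint
interiors whose union is the closure of `Ω`. In particular, every conforming triangulation of the
closure of `Ω` is such a mesh. -/
structure Mesh {n : ℕ} (Ω : Set (EuclideanSpace ℝ (Fin n))) where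
  cells : Finset (Affine.Simplex ℝ (EuclideanSpace ℝ (Fin n)) n)
  disjoint_interior : ∀ T ∈ cells, ∀ T' ∈ cells, T ≠ T' →
    Disjoint (interior (cell T)) (interior (cell T'))
  iUnion_cells : ⋃ T ∈ cells, cell T = closure Ω

namespace Mesh

variable {n : ℕ} {Ω : Set (EuclideanSpace ℝ (Fin n))}

/-- The mesh size `h`, the maximum of the diameters of the simplices of the mesh. -/
def size (𝒯 : Mesh Ω) : ℝ :=
  sSup ((fun T => Metric.diam (cell T)) ''
    (𝒯.cells : Set (Affine.Simplex ℝ (EuclideanSpace ℝ (Fin n)) n)))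

/-- The mesh is shape-regular with parameter `σ` relative to its mesh size `h`: each simplex of the
mesh contains a ball of diameter at least `h / σ`. (Since `h` is the size of the whole mesh, this
contains the classical condition on the ratio of the diameter of a simplex to that of its largest
inscribed ball, together with quasi-uniformity.) -/
def IsShapeRegular (𝒯 : Mesh Ω) (σ : ℝ) : Prop :=
  ∀ T ∈ 𝒯.cells, ∃ (c : EuclideanSpace ℝ (Fin n)) (r : ℝ),
    0 < r ∧ Metric.ball c r ⊆ cell T ∧ 𝒯.size ≤ σ * (2 * r)

/-- `v` is, on `Ω`, a continuous piecewise polynomial of degree at most `m` with respect to the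
mesh. The values of `v` outside `Ω` are irrelevant. -/
structure IsPiecewisePolynomial (𝒯 : Mesh Ω) (m : ℕ) (v : EuclideanSpace ℝ (Fin n) → ℝ) :
    Prop where
  continuousOn : ContinuousOn v Ω
  eq_polynomial : ∀ T ∈ 𝒯.cells, ∃ q : MvPolynomial (Fin n) ℝ, q.totalDegree ≤ m ∧
    ∀ x ∈ cell T ∩ Ω, v x = MvPolynomial.eval (fun i => x i) q

end Mesh

/-- The Gagliardo seminorm
`[v]_{W^{s,p}(Ω)} = (∫_Ω ∫_Ω |v(x) - v(y)|^p / |x - y|^{n + sp} dx dy)^{1/p}`, with value `∞` when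
the integral diverges. -/
def gagliardoSeminorm {n : ℕ} (Ω : Set (EuclideanSpace ℝ (Fin n))) (s p : ℝ)
    (v : EuclideanSpace ℝ (Fin n) → ℝ) : ℝ≥0∞ :=
  (∫⁻ y in Ω, ∫⁻ x in Ω,
    ENNReal.ofReal (|v x - v y| ^ p / ‖x - y‖ ^ ((n : ℝ) + s * p))) ^ (1 / p)

end FracInverse

end

noncomputable section

namespace FracInverse

/-! Substituting `x = y + z` turns the `p`-th power of the seminorm into the integral over `z` of
`‖z‖ ^ (-(n + s p))` times the translation modulus of `v`, the integral of `|v (y + z) - v y| ^ p`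
over those `y` with `y` and `y + z` in `Ω` (`lintegral_gagliardo_eq`). The heart is that this
modulus is at most `C * min 1 (‖z‖ / h)` times the `p`-th power of the `L^p` norm
(`Mesh.exists_lintegral_translate_sub_le`). The kernel weighted by this minimum is integrable
exactly because `0 < s p < 1`, and by scaling its integral is a multiple of `h ^ (-(s p))`
(`exists_lintegral_kernel_le`).

For `‖z‖ ≥ h` the modulus bound is the triangle inequality. For `‖z‖ < h`, either some cell contains
both points, and the Lipschitz inverse estimate gives `(‖z‖ / h) ^ p ≤ ‖z‖ / h`; or `y` and `y + z`
are separated by cell boundaries, which confines `y` to layers of relative volume `O(‖z‖ / h)`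
(`volume_diff_translate_le`), where the sup-norm inverse estimate suffices.

The inverse estimates need no reference simplex: a cell lies between an inscribed ball and a
concentric ball of radius `h`, of comparable radii. Equivalence of norms on polynomials of bounded
degree (`exists_polyFun_le_eLpNorm`), rescaled, does the rest. -/

variable {n : ℕ}

/-! ### Polynomials on balls: equivalence of norms and scaling. -/

/-- The function on `ℝⁿ` given by a polynomial in the coordinates. -/
def polyFun (q : MvPolynomial (Fin n) ℝ) (x : EuclideanSpace ℝ (Fin n)) : ℝ :=
  MvPolynomial.eval (fun i => x i) q

lemma contDiff_polyFun (q : MvPolynomial (Fin n) ℝ) : ContDiff ℝ 1 (polyFun q) := by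
  induction q using MvPolynomial.induction_on with
  | C a =>
    have e : polyFun (MvPolynomial.C a) = fun _ : EuclideanSpace ℝ (Fin n) => a := by
      ext x; simp [polyFun]
    rw [e]; exact contDiff_const
  | add p q hp hq =>
    have e : polyFun (p + q) = fun x : EuclideanSpace ℝ (Fin n) => polyFun p x + polyFun q x := by
      ext x; simp [polyFun]
    rw [e]; exact hp.add hq
  | mul_X p i hp =>
    have e : polyFun (p * MvPolynomial.X i) =
        fun x : EuclideanSpace ℝ (Fin n) => polyFun p x * x i := by
      ext x; simp [polyFun]
    rw [e]; exact hp.mul (by fun_prop)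

lemma continuous_polyFun (q : MvPolynomial (Fin n) ℝ) : Continuous (polyFun q) :=
  (contDiff_polyFun q).continuous

lemma polyFun_sum_smul {ι : Type*} (s : Finset ι) (a : ι → ℝ) (b : ι → MvPolynomial (Fin n) ℝ)
    (x : EuclideanSpace ℝ (Fin n)) :
    polyFun (∑ i ∈ s, a i • b i) x = ∑ i ∈ s, a i * polyFun (b i) x := by
  simp [polyFun, MvPolynomial.smul_eval]

lemma exists_bound_lipschitz_polyFun (q : MvPolynomial (Fin n) ℝ) (R : ℝ) :
    ∃ B : ℝ, 0 ≤ B ∧ (∀ u ∈ Metric.closedBall (0 : EuclideanSpace ℝ (Fin n)) R,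
      |polyFun q u| ≤ B) ∧
      ∀ u ∈ Metric.closedBall (0 : EuclideanSpace ℝ (Fin n)) R,
      ∀ w ∈ Metric.closedBall (0 : EuclideanSpace ℝ (Fin n)) R,
        |polyFun q u - polyFun q w| ≤ B * ‖u - w‖ := by
  have hc : IsCompact (Metric.closedBall (0 : EuclideanSpace ℝ (Fin n)) R) :=
    isCompact_closedBall _ _
  obtain ⟨A, hA⟩ := hc.exists_bound_of_continuousOn (continuous_polyFun q).continuousOn
  obtain ⟨K, hK⟩ := LocallyLipschitzOn.exists_lipschitzOnWith_of_compact hc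
    (contDiff_polyFun q).locallyLipschitz.locallyLipschitzOn
  refine ⟨max (max A K) 0, le_max_right _ _, fun u hu => ?_, fun u hu w hw => ?_⟩
  · exact (hA u hu).trans ((le_max_left _ _).trans (le_max_left _ _))
  · have h := hK.dist_le_mul u hu w hw
    rw [Real.dist_eq, dist_eq_norm] at h
    exact h.trans (mul_le_mul_of_nonneg_right ((le_max_right _ _).trans (le_max_left _ _))
      (norm_nonneg _))

/-- The ball contains a product of intervals, and a polynomial vanishing on a product of infinite
sets is zero. -/
lemma eq_zero_of_polyFun_eq_zero_on_ball (q : MvPolynomial (Fin n) ℝ) {ρ : ℝ} (hρ : 0 < ρ)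
    (h : ∀ x ∈ Metric.ball (0 : EuclideanSpace ℝ (Fin n)) ρ, polyFun q x = 0) : q = 0 := by
  have hopen : IsOpen ((WithLp.toLp 2 : (Fin n → ℝ) → EuclideanSpace ℝ (Fin n)) ⁻¹'
      Metric.ball 0 ρ) :=
    Metric.isOpen_ball.preimage (PiLp.continuous_toLp 2 _)
  obtain ⟨ε, hε, hball⟩ := Metric.isOpen_iff.1 hopen 0 (by simpa using hρ)
  refine MvPolynomial.funext_set (fun _ => Metric.ball (0 : ℝ) ε) (fun i => ?_) fun x hx => ?_
  · rw [Real.ball_eq_Ioo]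
    exact Set.Ioo_infinite (by linarith)
  · have : x ∈ Metric.ball (0 : Fin n → ℝ) ε := by
      rw [Metric.mem_ball, dist_pi_lt_iff hε]
      exact fun i => hx i trivial
    simpa [polyFun] using h _ (hball this)

lemma memLp_polyFun_ball (q : MvPolynomial (Fin n) ℝ) (ρ : ℝ) (p : ℝ≥0∞) :
    MemLp (polyFun q) p
      (volume.restrict (Metric.ball (0 : EuclideanSpace ℝ (Fin n)) ρ)) := by
  obtain ⟨B, -, hB, -⟩ := exists_bound_lipschitz_polyFun q ρ
  have : IsFiniteMeasure
      (volume.restrict (Metric.ball (0 : EuclideanSpace ℝ (Fin n)) ρ)) :=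
    ⟨by simpa using measure_ball_lt_top⟩
  refine MemLp.of_bound (continuous_polyFun q).aestronglyMeasurable B ?_
  filter_upwards [ae_restrict_mem Metric.isOpen_ball.measurableSet] with x hx
  exact hB x (Metric.ball_subset_closedBall hx)

/-- The restriction of polynomials to a ball, as a linear map into `L^p`. -/
def polyToLp (n : ℕ) (ρ : ℝ) (p : ℝ≥0∞) : MvPolynomial (Fin n) ℝ →ₗ[ℝ]
    Lp ℝ p (volume.restrict (Metric.ball (0 : EuclideanSpace ℝ (Fin n)) ρ)) where
  toFun q := (memLp_polyFun_ball q ρ p).toLp _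
  map_add' q q' := by
    rw [← MemLp.toLp_add]
    exact MemLp.toLp_congr _ _ (Filter.Eventually.of_forall fun x => by simp [polyFun])
  map_smul' a q := by
    rw [RingHom.id_apply, ← MemLp.toLp_const_smul]
    exact MemLp.toLp_congr _ _
      (Filter.Eventually.of_forall fun x => by simp [polyFun, MvPolynomial.smul_eval])

lemma polyToLp_injective {ρ : ℝ} (hρ : 0 < ρ) (p : ℝ≥0∞) :
    Function.Injective (polyToLp n ρ p) := by
  rw [injective_iff_map_eq_zero]
  intro q hq
  have h0 : polyFun q =ᵐ[volume.restrict (Metric.ball 0 ρ)] fun _ => (0 : ℝ) := by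
    have h1 := (memLp_polyFun_ball q ρ p).coeFn_toLp
    have h2 := Lp.coeFn_zero ℝ p
      (volume.restrict (Metric.ball (0 : EuclideanSpace ℝ (Fin n)) ρ))
    rw [← hq] at h2
    exact h1.symm.trans h2
  exact eq_zero_of_polyFun_eq_zero_on_ball q hρ
    (Measure.eqOn_open_of_ae_eq h0 Metric.isOpen_ball (continuous_polyFun q).continuousOn
      continuousOn_const)

/-- Equivalence of norms on polynomials of bounded degree: the `L^p` norm on a ball controls the
supremum and the Lipschitz constant on the unit ball. -/
lemma exists_polyFun_le_eLpNorm (n m : ℕ) {ρ : ℝ} (hρ : 0 < ρ) {p : ℝ≥0∞} (hp : 1 ≤ p) :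
    ∃ K : ℝ, 0 ≤ K ∧ ∀ q : MvPolynomial (Fin n) ℝ, q.totalDegree ≤ m →
      (∀ u ∈ Metric.closedBall (0 : EuclideanSpace ℝ (Fin n)) 1, ‖polyFun q u‖ₑ ≤
        ENNReal.ofReal K * eLpNorm (polyFun q) p (volume.restrict (Metric.ball 0 ρ))) ∧
      ∀ u ∈ Metric.closedBall (0 : EuclideanSpace ℝ (Fin n)) 1,
      ∀ w ∈ Metric.closedBall (0 : EuclideanSpace ℝ (Fin n)) 1, ‖polyFun q u - polyFun q w‖ₑ ≤
        ENNReal.ofReal (K * ‖u - w‖) *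
          eLpNorm (polyFun q) p (volume.restrict (Metric.ball 0 ρ)) := by
  have : Fact (1 ≤ p) := ⟨hp⟩
  let P := MvPolynomial.restrictTotalDegree (Fin n) ℝ m
  let b := Module.finBasis ℝ P
  let f : P →ₗ[ℝ] _ := polyToLp n ρ p ∘ₗ P.subtype
  have hf : Function.Injective f := (polyToLp_injective hρ p).comp P.injective_subtype
  let e := LinearEquiv.ofInjective f hf
  -- The coordinate map is linear on a finite-dimensional subspace of `L^p`, hence bounded; its
  -- operator norm controls the coefficients by the `L^p` norm.
  let g : LinearMap.range f →ₗ[ℝ] (Fin (Module.finrank ℝ P) → ℝ) :=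
    b.equivFun.toLinearMap ∘ₗ e.symm.toLinearMap
  let G := LinearMap.toContinuousLinearMap g
  choose B hB0 hB hBl using fun i => exists_bound_lipschitz_polyFun (b i : MvPolynomial (Fin n) ℝ) 1
  have hK0 : 0 ≤ ‖G‖ * ∑ i, B i := by
    have := Finset.sum_nonneg fun i (_ : i ∈ Finset.univ) => hB0 i
    positivity
  refine ⟨‖G‖ * ∑ i, B i, hK0, fun q hq => ?_⟩
  let q' : P := ⟨q, (MvPolynomial.mem_restrictTotalDegree _ _ _).2 hq⟩
  set N := eLpNorm (polyFun q) p
    (volume.restrict (Metric.ball (0 : EuclideanSpace ℝ (Fin n)) ρ)) with hN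
  have hNtop : N ≠ ∞ := (memLp_polyFun_ball q ρ p).eLpNorm_ne_top
  have hnorm : ‖f q'‖ = N.toReal := Lp.norm_toLp _ (memLp_polyFun_ball q ρ p)
  have hcoef : ∀ i, |b.repr q' i| ≤ ‖G‖ * N.toReal := by
    intro i
    have h1 : G (e q') i = b.repr q' i := by
      change b.equivFun (e.symm (e q')) i = _
      rw [e.symm_apply_apply, Module.Basis.equivFun_apply]
    have h2 : ‖G (e q')‖ ≤ ‖G‖ * ‖e q'‖ := G.le_opNorm _
    have h3 : ‖e q'‖ = ‖f q'‖ := rfl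
    rw [← h1, ← hnorm, ← h3]
    exact (norm_le_pi_norm (G (e q')) i).trans h2
  have hsum : q = ∑ i, b.repr q' i • (b i : MvPolynomial (Fin n) ℝ) := by
    have := (congrArg Subtype.val (b.sum_repr q')).symm
    rwa [Submodule.coe_sum] at this
  -- Serves both estimates: `φ` is the values of the basis polynomials with `t = 1`, or their
  -- increments with `t = ‖u - w‖`.
  have key : ∀ (φ : Fin (Module.finrank ℝ P) → ℝ) (t : ℝ), (∀ i, |φ i| ≤ B i * t) → 0 ≤ t →
      ‖∑ i, b.repr q' i * φ i‖ₑ ≤ ENNReal.ofReal (‖G‖ * (∑ i, B i) * t) * N := by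
    intro φ t hφ ht
    rw [← ENNReal.ofReal_toReal hNtop, ← ENNReal.ofReal_mul (by positivity),
      Real.enorm_eq_ofReal_abs]
    apply ENNReal.ofReal_le_ofReal
    calc |∑ i, b.repr q' i * φ i| ≤ ∑ i, |b.repr q' i * φ i| := Finset.abs_sum_le_sum_abs _ _
      _ ≤ ∑ i, (‖G‖ * N.toReal) * (B i * t) := by
          refine Finset.sum_le_sum fun i _ => ?_
          rw [abs_mul]
          exact mul_le_mul (hcoef i) (hφ i) (abs_nonneg _) (by positivity)
      _ = ‖G‖ * (∑ i, B i) * t * N.toReal := by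
          rw [← Finset.mul_sum, ← Finset.sum_mul]; ring
  refine ⟨fun u hu => ?_, fun u hu w hw => ?_⟩
  · have := key (fun i => polyFun (b i : MvPolynomial (Fin n) ℝ) u) 1
      (fun i => by simpa using hB i u hu) zero_le_one
    rw [mul_one] at this
    rwa [hsum, polyFun_sum_smul]
  · have := key (fun i => polyFun (b i : MvPolynomial (Fin n) ℝ) u
      - polyFun (b i : MvPolynomial (Fin n) ℝ) w) ‖u - w‖ (fun i => hBl i u hu w hw)
      (norm_nonneg _)
    convert this using 2
    rw [hsum, polyFun_sum_smul, polyFun_sum_smul, ← Finset.sum_sub_distrib]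
    exact Finset.sum_congr rfl fun i _ => by ring

/-- Substituting an affine change of scale does not raise the degree. -/
lemma exists_polyFun_comp_homothety (q : MvPolynomial (Fin n) ℝ) (c : EuclideanSpace ℝ (Fin n))
    (h : ℝ) : ∃ q' : MvPolynomial (Fin n) ℝ, q'.totalDegree ≤ q.totalDegree ∧
      ∀ u, polyFun q' u = polyFun q (c + h • u) := by
  refine ⟨MvPolynomial.bind₁ (fun i => MvPolynomial.C (c i) + MvPolynomial.C h * MvPolynomial.X i) q,
    ?_, fun u => ?_⟩
  · rw [MvPolynomial.bind₁, MvPolynomial.aeval_def, MvPolynomial.eval₂_eq]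
    refine (MvPolynomial.totalDegree_finsetSum _ _).trans (Finset.sup_le fun d hd => ?_)
    refine (MvPolynomial.totalDegree_mul _ _).trans ?_
    rw [MvPolynomial.algebraMap_eq, MvPolynomial.totalDegree_C, zero_add]
    refine (MvPolynomial.totalDegree_finsetProd _ _).trans ?_
    refine le_trans ?_ (MvPolynomial.le_totalDegree hd)
    rw [Finsupp.sum]
    refine Finset.sum_le_sum fun i _ => (MvPolynomial.totalDegree_pow _ _).trans ?_
    have h1 : (MvPolynomial.C (c i) + MvPolynomial.C h * MvPolynomial.X i :
        MvPolynomial (Fin n) ℝ).totalDegree ≤ 1 := by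
      refine (MvPolynomial.totalDegree_add _ _).trans (max_le (by simp) ?_)
      refine (MvPolynomial.totalDegree_mul _ _).trans ?_
      simp [MvPolynomial.totalDegree_X]
    simpa using Nat.mul_le_mul_left (d i) h1
  · unfold polyFun
    rw [MvPolynomial.eval, MvPolynomial.eval₂Hom_bind₁]
    congr 2
    ext i
    simp

/-- Scaled inverse estimates for a polynomial on a ball of radius `h`, in terms of its `L^p` norm
on a concentric ball of comparable radius. -/
lemma exists_inverse_estimate (n m : ℕ) {ρ : ℝ} (hρ : 0 < ρ) {p : ℝ} (hp : 1 ≤ p) :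
    ∃ K : ℝ, 0 ≤ K ∧ ∀ q : MvPolynomial (Fin n) ℝ, q.totalDegree ≤ m →
      ∀ (c : EuclideanSpace ℝ (Fin n)) (h r : ℝ), 0 < h → ρ * h ≤ r →
      (∀ x ∈ Metric.closedBall c h, ‖polyFun q x‖ₑ ^ p ≤
        ENNReal.ofReal (K / h ^ n) * ∫⁻ y in Metric.ball c r, ‖polyFun q y‖ₑ ^ p) ∧
      ∀ x ∈ Metric.closedBall c h, ∀ y ∈ Metric.closedBall c h,
        ‖polyFun q x - polyFun q y‖ₑ ^ p ≤
        ENNReal.ofReal (K / h ^ n * (‖x - y‖ / h) ^ p) *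
          ∫⁻ y in Metric.ball c r, ‖polyFun q y‖ₑ ^ p := by
  have hp0 : 0 < p := by linarith
  obtain ⟨K, hK, H⟩ := exists_polyFun_le_eLpNorm n m hρ
    (p := ENNReal.ofReal p) (by simpa using hp)
  refine ⟨K ^ p, by positivity, fun q hq c h r hh hr => ?_⟩
  obtain ⟨q', hq', hqq⟩ := exists_polyFun_comp_homothety q c h
  obtain ⟨H1, H2⟩ := H q' (hq'.trans hq)
  set N := eLpNorm (polyFun q') (ENNReal.ofReal p)
    (volume.restrict (Metric.ball (0 : EuclideanSpace ℝ (Fin n)) ρ)) with hN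
  set I := ∫⁻ y in Metric.ball c r, ‖polyFun q y‖ₑ ^ p with hI
  -- Change of variables with Jacobian `h ^ n`; only an inequality, since the image ball has radius
  -- `ρ * h ≤ r`.
  have hNI : N ^ p ≤ ENNReal.ofReal (1 / h ^ n) * I := by
    rw [hN, eLpNorm_eq_lintegral_rpow_enorm_toReal (by simpa using hp0) (by simp),
      ENNReal.toReal_ofReal hp0.le, ← ENNReal.rpow_mul, one_div_mul_cancel hp0.ne',
      ENNReal.rpow_one]
    have hmap : Measure.map (fun u : EuclideanSpace ℝ (Fin n) => c + h • u) volume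
        = ENNReal.ofReal (1 / h ^ n) • volume := by
      have e1 : (fun u : EuclideanSpace ℝ (Fin n) => c + h • u)
          = (fun u => c + u) ∘ (fun u => h • u) := rfl
      rw [e1, ← Measure.map_map (by fun_prop) (by fun_prop), Measure.map_addHaar_smul _ hh.ne',
        Measure.map_smul, map_add_left_eq_self]
      simp [abs_of_pos hh]
    have hme : Measurable fun y : EuclideanSpace ℝ (Fin n) => ‖polyFun q y‖ₑ ^ p :=
      (continuous_polyFun q).measurable.enorm.pow_const p
    calc ∫⁻ u in Metric.ball 0 ρ, ‖polyFun q' u‖ₑ ^ p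
        = ∫⁻ u, (Metric.ball 0 ρ).indicator (fun u => ‖polyFun q' u‖ₑ ^ p) u := by
          rw [lintegral_indicator Metric.isOpen_ball.measurableSet]
      _ ≤ ∫⁻ u, (Metric.ball c r).indicator (fun y => ‖polyFun q y‖ₑ ^ p) (c + h • u) := by
          refine lintegral_mono fun u => ?_
          refine Set.indicator_apply_le' (fun hu => ?_) fun _ => zero_le
          rw [Set.indicator_of_mem, hqq]
          rw [Metric.mem_ball, dist_eq_norm, add_sub_cancel_left, norm_smul, Real.norm_eq_abs,
            abs_of_pos hh]
          rw [mem_ball_zero_iff] at hu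
          nlinarith
      _ = ∫⁻ y, (Metric.ball c r).indicator (fun y => ‖polyFun q y‖ₑ ^ p) y
            ∂(Measure.map (fun u : EuclideanSpace ℝ (Fin n) => c + h • u) volume) := by
          rw [lintegral_map (hme.indicator Metric.isOpen_ball.measurableSet) (by fun_prop)]
      _ = ENNReal.ofReal (1 / h ^ n) * I := by
          rw [hmap, lintegral_smul_measure, lintegral_indicator Metric.isOpen_ball.measurableSet,
            smul_eq_mul]
  have hball : ∀ x ∈ Metric.closedBall c h, ∃ u ∈ Metric.closedBall
      (0 : EuclideanSpace ℝ (Fin n)) 1, x = c + h • u := by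
    intro x hx
    refine ⟨h⁻¹ • (x - c), ?_, ?_⟩
    · rw [mem_closedBall_zero_iff, norm_smul, norm_inv, Real.norm_eq_abs, abs_of_pos hh,
        ← dist_eq_norm]
      rw [inv_mul_le_iff₀ hh, mul_one]
      exact hx
    · rw [smul_smul, mul_inv_cancel₀ hh.ne', one_smul, add_sub_cancel]
  have fin : ∀ (t : ℝ) (a : ℝ≥0∞), 0 ≤ t → a ≤ ENNReal.ofReal (K * t) * N →
      a ^ p ≤ ENNReal.ofReal (K ^ p / h ^ n * t ^ p) * I := by
    intro t a ht ha
    calc a ^ p ≤ (ENNReal.ofReal (K * t) * N) ^ p := ENNReal.rpow_le_rpow ha hp0.le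
      _ = ENNReal.ofReal ((K * t) ^ p) * N ^ p := by
          rw [ENNReal.mul_rpow_of_nonneg _ _ hp0.le,
            ENNReal.ofReal_rpow_of_nonneg (by positivity) hp0.le]
      _ ≤ ENNReal.ofReal ((K * t) ^ p) * (ENNReal.ofReal (1 / h ^ n) * I) := by gcongr
      _ = _ := by
          rw [← mul_assoc, ← ENNReal.ofReal_mul (by positivity), Real.mul_rpow hK ht]
          congr 2; ring
  refine ⟨fun x hx => ?_, fun x hx y hy => ?_⟩
  · obtain ⟨u, hu, rfl⟩ := hball x hx
    have := fin 1 _ zero_le_one (by simpa using H1 u hu)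
    simpa [hqq] using this
  · obtain ⟨u, hu, rfl⟩ := hball x hx
    obtain ⟨w, hw, rfl⟩ := hball y hy
    have := fin _ _ (norm_nonneg _) (H2 u hu w hw)
    have e : ‖c + h • u - (c + h • w)‖ / h = ‖u - w‖ := by
      rw [add_sub_add_left_eq_sub, ← smul_sub, norm_smul, Real.norm_eq_abs, abs_of_pos hh]
      field_simp
    rwa [e, ← hqq, ← hqq]

/-! ### Volumes: translates of convex sets and polygonal boundaries. -/

/-- Translating a convex set that contains a ball of radius `r` by a vector `z` moves at most a
fraction of order `‖z‖ / r` of its volume outside of it. -/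
lemma volume_diff_translate_le {T : Set (EuclideanSpace ℝ (Fin n))} (hT : Convex ℝ T)
    (hTm : MeasurableSet T) (hTfin : volume T ≠ ∞) {c : EuclideanSpace ℝ (Fin n)} {r : ℝ}
    (hr : 0 < r) (hc : Metric.ball c r ⊆ T) (z : EuclideanSpace ℝ (Fin n)) :
    volume (T \ {x | x + z ∈ T}) ≤ ENNReal.ofReal (n * (2 * ‖z‖ / r)) * volume T := by
  rcases Nat.eq_zero_or_pos n with hn | hn
  · subst hn
    have : T \ {x | x + z ∈ T} = ∅ := by
      ext x
      simp [Subsingleton.elim (x + z) x]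
    simp [this]
  have hn1 : (1 : ℝ) ≤ n := by exact_mod_cast hn
  set l := 2 * ‖z‖ / r with hl
  have hl0 : 0 ≤ l := by positivity
  rcases le_or_gt 1 l with h1 | h1
  · calc volume (T \ {x | x + z ∈ T}) ≤ volume T := measure_mono Set.sdiff_subset
      _ = 1 * volume T := (one_mul _).symm
      _ ≤ _ := by
        gcongr
        rw [ENNReal.one_le_ofReal]
        nlinarith
  -- Shrinking `T` towards `c` leaves room to translate: `(1 - l) • t + l • c + z` is a convex
  -- combination of `t` and `c + l⁻¹ • z`, and `l` is chosen so that `l⁻¹ • z` has norm `r / 2` when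
  -- `z ≠ 0`. So `S` misses the difference set, and Bernoulli bounds `1 - (1 - l) ^ n`.
  set S := AffineMap.homothety c (1 - l) '' T with hS
  have hcT : c ∈ T := hc (Metric.mem_ball_self hr)
  have hST : S ⊆ T ∩ {x | x + z ∈ T} := by
    rintro _ ⟨t, ht, rfl⟩
    have e : AffineMap.homothety c (1 - l) t = (1 - l) • t + l • c := by
      rw [AffineMap.homothety_apply, vsub_eq_sub, vadd_eq_add]; module
    refine ⟨?_, ?_⟩
    · rw [e]
      exact hT ht hcT (by linarith) hl0 (by ring)
    · have hw : c + (l⁻¹ • z) ∈ T := by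
        apply hc
        rw [Metric.mem_ball, dist_eq_norm, add_sub_cancel_left, norm_smul, norm_inv,
          Real.norm_eq_abs, abs_of_nonneg hl0]
        rcases eq_or_ne z 0 with rfl | hz
        · simpa using hr
        · have hz' : 0 < ‖z‖ := norm_pos_iff.2 hz
          have : l⁻¹ * ‖z‖ = r / 2 := by rw [hl]; field_simp
          rw [this]; linarith
      have e2 : AffineMap.homothety c (1 - l) t + z = (1 - l) • t + l • (c + l⁻¹ • z) := by
        rw [e, smul_add, smul_smul]
        rcases eq_or_ne z 0 with rfl | hz
        · simp
        · have hz' : 0 < ‖z‖ := norm_pos_iff.2 hz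
          rw [mul_inv_cancel₀ (by positivity), one_smul, add_assoc]
      rw [Set.mem_ofPred_eq, e2]
      exact hT ht hw (by linarith) hl0 (by ring)
  have hvS : volume S = ENNReal.ofReal ((1 - l) ^ n) * volume T := by
    rw [hS, Measure.addHaar_image_homothety, finrank_euclideanSpace_fin, abs_of_nonneg]
    exact pow_nonneg (by linarith) _
  have hSm : MeasurableSet {x | x + z ∈ T} := hTm.preimage (measurable_add_const z)
  have hsub : volume (T \ {x | x + z ∈ T}) + volume S ≤ volume T := by
    calc _ ≤ volume (T \ {x | x + z ∈ T}) + volume (T ∩ {x | x + z ∈ T}) := by gcongr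
      _ = volume T := by rw [add_comm]; exact measure_inter_add_sdiff _ hSm
  have hbern : 1 - n * l ≤ (1 - l) ^ n := by
    have := one_add_mul_le_pow (a := -l) (by linarith) n
    simpa [sub_eq_add_neg, mul_comm] using this
  have hfin : volume S ≠ ∞ := by
    rw [hvS]; exact ENNReal.mul_ne_top ENNReal.ofReal_ne_top hTfin
  refine (ENNReal.le_sub_of_add_le_right hfin hsub).trans ?_
  rw [tsub_le_iff_right, hvS, ← add_mul]
  rw [← ENNReal.ofReal_add (by positivity) (pow_nonneg (by linarith) _)]
  calc volume T = 1 * volume T := (one_mul _).symm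
    _ ≤ _ := by
      gcongr
      rw [ENNReal.one_le_ofReal]
      linarith

/-- The boundary of a polygonal domain is a null set. -/
lemma IsPolygonalDomain.volume_frontier {Ω : Set (EuclideanSpace ℝ (Fin n))}
    (hΩ : IsPolygonalDomain Ω) : volume (frontier Ω) = 0 := by
  obtain ⟨F, hF⟩ := hΩ.frontier_eq
  -- The boundary of an open set has empty interior, so each polytope in it does too; a closed
  -- convex set without interior is its own frontier, which is null.
  have hint : interior (frontier Ω) = ∅ := by
    rw [← frontier_compl]; exact interior_frontier hΩ.isOpen.isClosed_compl
  rw [hF]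
  refine (measure_biUnion_null_iff F.countable_toSet).2 fun P hP => ?_
  have hcl : IsClosed (convexHull ℝ (P : Set (EuclideanSpace ℝ (Fin n)))) :=
    P.finite_toSet.isClosed_convexHull ℝ
  have hsub : convexHull ℝ (P : Set (EuclideanSpace ℝ (Fin n))) ⊆ frontier Ω := by
    rw [hF]; exact Set.subset_biUnion_of_mem 
      (u := fun P : Finset (EuclideanSpace ℝ (Fin n)) =>
        convexHull ℝ (P : Set (EuclideanSpace ℝ (Fin n)))) hP
  have hi : interior (convexHull ℝ (P : Set (EuclideanSpace ℝ (Fin n)))) = ∅ :=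
    Set.subset_eq_empty (interior_mono hsub) hint
  have := (convex_convexHull ℝ (P : Set (EuclideanSpace ℝ (Fin n)))).addHaar_frontier volume
  rwa [frontier, hi, Set.sdiff_empty, hcl.closure_eq] at this

/-! ### The radial kernel. -/

/-- The kernel of the Gagliardo seminorm, tempered by one power of the distance near the diagonal,
is integrable, and scales with the mesh size. -/
lemma exists_lintegral_kernel_le (n : ℕ) (hn : 1 ≤ n) {a : ℝ} (ha0 : 0 < a) (ha1 : a < 1) :
    ∃ M : ℝ, 0 ≤ M ∧ ∀ h : ℝ, 0 < h →
      ∫⁻ z : EuclideanSpace ℝ (Fin n),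
        ENNReal.ofReal (1 / ‖z‖ ^ ((n : ℝ) + a) * min 1 (‖z‖ / h)) ≤
          ENNReal.ofReal (M * h ^ (-a)) := by
  have : Nonempty (Fin n) := ⟨⟨0, hn⟩⟩
  have : Nontrivial (EuclideanSpace ℝ (Fin n)) := inferInstance
  set k : ℝ → ℝ := fun y => 1 / y ^ ((n : ℝ) + a) * min 1 y with hk
  have hk0 : ∀ y, 0 ≤ y → 0 ≤ k y := fun y hy => by
    simp only [hk]
    have := le_min zero_le_one hy
    positivity
  -- In polar coordinates the density is `y ^ (-a)` on `(0, 1]`, integrable as `a < 1`, and `y ^ (-1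
  -- - a)` beyond, integrable as `a > 0`.
  have hint : Integrable (fun w : EuclideanSpace ℝ (Fin n) => k ‖w‖) := by
    rw [integrable_fun_norm_addHaar]
    rw [finrank_euclideanSpace_fin]
    have hsplit : Set.Ioi (0 : ℝ) = Set.Ioc 0 1 ∪ Set.Ioi 1 :=
      (Set.Ioc_union_Ioi_eq_Ioi zero_le_one).symm
    have hpow : ∀ y : ℝ, 0 < y → y ^ (n - 1) * (1 / y ^ ((n : ℝ) + a)) = y ^ (-1 - a) := by
      intro y hy
      rw [← Real.rpow_natCast, one_div, ← Real.rpow_neg hy.le, ← Real.rpow_add hy,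
        Nat.cast_sub hn]
      congr 1; push_cast; ring
    rw [hsplit, integrableOn_union]
    constructor
    · have : IntegrableOn (fun y : ℝ => y ^ (-a)) (Set.Ioc 0 1) := by
        rw [← intervalIntegrable_iff_integrableOn_Ioc_of_le zero_le_one]
        exact intervalIntegral.intervalIntegrable_rpow' (by linarith)
      refine this.congr_fun (fun y hy => ?_) measurableSet_Ioc
      simp only [hk, smul_eq_mul]
      rw [min_eq_right hy.2, ← mul_assoc, hpow y hy.1, ← Real.rpow_add_one hy.1.ne']
      congr 1; ring
    · have : IntegrableOn (fun y : ℝ => y ^ (-1 - a)) (Set.Ioi 1) :=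
        integrableOn_Ioi_rpow_of_lt (by linarith) zero_lt_one
      refine this.congr_fun (fun y hy => ?_) measurableSet_Ioi
      have hy0 : (0 : ℝ) < y := zero_lt_one.trans hy
      simp only [hk, smul_eq_mul]
      rw [min_eq_left (le_of_lt hy), mul_one, hpow y hy0]
  set M := ∫ w : EuclideanSpace ℝ (Fin n), k ‖w‖ with hM
  have hM0 : 0 ≤ M := integral_nonneg fun w => hk0 _ (norm_nonneg _)
  refine ⟨M, hM0, fun h hh => ?_⟩
  have hlin : ∫⁻ w : EuclideanSpace ℝ (Fin n), ENNReal.ofReal (k ‖w‖) = ENNReal.ofReal M :=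
    (ofReal_integral_eq_lintegral_ofReal hint
      (Filter.Eventually.of_forall fun w => hk0 _ (norm_nonneg _))).symm
  have hmk : Measurable fun w : EuclideanSpace ℝ (Fin n) => ENNReal.ofReal (k ‖w‖) := by
    simp only [hk]; fun_prop
  have hmap := Measure.map_addHaar_smul (volume : Measure (EuclideanSpace ℝ (Fin n)))
    (inv_ne_zero hh.ne')
  have hscale : ∫⁻ z : EuclideanSpace ℝ (Fin n), ENNReal.ofReal (k ‖h⁻¹ • z‖)
      = ENNReal.ofReal (h ^ n) * ENNReal.ofReal M := by
    rw [← lintegral_map (f := fun w : EuclideanSpace ℝ (Fin n) => ENNReal.ofReal (k ‖w‖)) hmk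
      (measurable_const_smul _), hmap, lintegral_smul_measure, hlin, smul_eq_mul]
    simp [abs_of_pos hh]
  have hpt : ∀ z : EuclideanSpace ℝ (Fin n),
      ENNReal.ofReal (1 / ‖z‖ ^ ((n : ℝ) + a) * min 1 (‖z‖ / h)) =
        ENNReal.ofReal (h ^ (-((n : ℝ) + a))) * ENNReal.ofReal (k ‖h⁻¹ • z‖) := by
    intro z
    rw [← ENNReal.ofReal_mul (by positivity)]
    congr 1
    have e : ‖h⁻¹ • z‖ = ‖z‖ / h := by
      rw [norm_smul, norm_inv, Real.norm_eq_abs, abs_of_pos hh]; field_simp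
    simp only [hk, e]
    rw [Real.div_rpow (norm_nonneg _) hh.le, Real.rpow_neg hh.le, ← mul_assoc]
    congr 1
    have : h ^ ((n : ℝ) + a) ≠ 0 := by positivity
    rw [one_div_div]
    field_simp
  simp_rw [hpt]
  rw [lintegral_const_mul' _ _ ENNReal.ofReal_ne_top, hscale, ← ENNReal.ofReal_mul (by positivity),
    ← ENNReal.ofReal_mul (by positivity)]
  apply le_of_eq
  congr 1
  have : h ^ (-((n : ℝ) + a)) * h ^ n = h ^ (-a) := by
    rw [← Real.rpow_natCast, ← Real.rpow_add hh]; congr 1; ring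
  rw [← mul_assoc, this, mul_comm]

/-! ### Cells of a mesh and inverse estimates on them. -/

variable {Ω : Set (EuclideanSpace ℝ (Fin n))}

lemma convex_cell (T : Affine.Simplex ℝ (EuclideanSpace ℝ (Fin n)) n) : Convex ℝ (cell T) :=
  convex_convexHull ℝ _

lemma isCompact_cell (T : Affine.Simplex ℝ (EuclideanSpace ℝ (Fin n)) n) : IsCompact (cell T) :=
  (Set.finite_range _).isCompact_convexHull ℝ

lemma measurableSet_cell (T : Affine.Simplex ℝ (EuclideanSpace ℝ (Fin n)) n) :
    MeasurableSet (cell T) :=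
  (isCompact_cell T).isClosed.measurableSet

namespace Mesh

lemma diam_cell_le_size (𝒯 : Mesh Ω) {T : Affine.Simplex ℝ (EuclideanSpace ℝ (Fin n)) n}
    (hT : T ∈ 𝒯.cells) : Metric.diam (cell T) ≤ 𝒯.size :=
  le_csSup (𝒯.cells.finite_toSet.image _).bddAbove (Set.mem_image_of_mem _ hT)

lemma cell_subset_closedBall (𝒯 : Mesh Ω) {T : Affine.Simplex ℝ (EuclideanSpace ℝ (Fin n)) n}
    (hT : T ∈ 𝒯.cells) {c : EuclideanSpace ℝ (Fin n)} (hc : c ∈ cell T) :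
    cell T ⊆ Metric.closedBall c 𝒯.size := fun _ hx =>
  (Metric.dist_le_diam_of_mem (isCompact_cell T).isBounded hx hc).trans (𝒯.diam_cell_le_size hT)

lemma exists_cell_of_mem (𝒯 : Mesh Ω) {x : EuclideanSpace ℝ (Fin n)} (hx : x ∈ Ω) :
    ∃ T ∈ 𝒯.cells, x ∈ cell T := by
  have := subset_closure hx
  rw [← 𝒯.iUnion_cells] at this
  simpa using this

lemma cell_subset_closure (𝒯 : Mesh Ω) {T : Affine.Simplex ℝ (EuclideanSpace ℝ (Fin n)) n}
    (hT : T ∈ 𝒯.cells) : cell T ⊆ closure Ω := by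
  rw [← 𝒯.iUnion_cells]
  exact Set.subset_biUnion_of_mem (u := cell) hT

lemma size_pos (𝒯 : Mesh Ω) (hn : 1 ≤ n) (hΩ : Ω.Nonempty) : 0 < 𝒯.size := by
  obtain ⟨x, hx⟩ := hΩ
  obtain ⟨T, hT, -⟩ := 𝒯.exists_cell_of_mem hx
  refine lt_of_lt_of_le ?_ (𝒯.diam_cell_le_size hT)
  have hne : (⟨0, by omega⟩ : Fin (n + 1)) ≠ ⟨1, by omega⟩ := by simp
  have h := T.independent.injective.ne hne
  exact (dist_pos.2 h).trans_le (Metric.dist_le_diam_of_mem (isCompact_cell T).isBounded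
    (subset_convexHull ℝ _ ⟨_, rfl⟩) (subset_convexHull ℝ _ ⟨_, rfl⟩))

lemma volume_cell_le (𝒯 : Mesh Ω) (hh : 0 ≤ 𝒯.size)
    {T : Affine.Simplex ℝ (EuclideanSpace ℝ (Fin n)) n} (hT : T ∈ 𝒯.cells) :
    volume (cell T) ≤ ENNReal.ofReal
      (𝒯.size ^ n * volume.real (Metric.ball (0 : EuclideanSpace ℝ (Fin n)) 1)) := by
  have hc : T.points 0 ∈ cell T := subset_convexHull ℝ _ ⟨_, rfl⟩
  refine (measure_mono (𝒯.cell_subset_closedBall hT hc)).trans ?_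
  rw [Measure.addHaar_closedBall _ _ hh, finrank_euclideanSpace_fin,
    ENNReal.ofReal_mul (by positivity), Measure.real, ENNReal.ofReal_toReal measure_ball_lt_top.ne]

/-- Cells may share faces, so local norms are taken over interiors, whose disjointness makes them
add up without overlap. -/
lemma sum_setLIntegral_interior_cell_le (𝒯 : Mesh Ω) (hΩ : MeasurableSet Ω)
    (f : EuclideanSpace ℝ (Fin n) → ℝ≥0∞) :
    ∑ T ∈ 𝒯.cells, ∫⁻ x in interior (cell T) ∩ Ω, f x ≤ ∫⁻ x in Ω, f x := by
  rw [← lintegral_biUnion_finset]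
  · exact lintegral_mono_set (Set.iUnion₂_subset fun T _ => Set.inter_subset_right)
  · intro T hT T' hT' hne
    exact (𝒯.disjoint_interior T hT T' hT' hne).mono Set.inter_subset_left Set.inter_subset_left
  · exact fun T _ => isOpen_interior.measurableSet.inter hΩ

/-- Inverse estimates for piecewise polynomials on the cells of a shape-regular mesh. -/
lemma exists_cell_estimate (n m : ℕ) {σ p : ℝ} (hσ : 0 < σ) (hp : 1 ≤ p) :
    ∃ K : ℝ, 0 ≤ K ∧ ∀ Ω : Set (EuclideanSpace ℝ (Fin n)), MeasurableSet Ω →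
      volume (frontier Ω) = 0 →
      ∀ 𝒯 : Mesh Ω, 0 < 𝒯.size → 𝒯.IsShapeRegular σ → ∀ v, 𝒯.IsPiecewisePolynomial m v →
      ∀ T ∈ 𝒯.cells,
      (∀ x ∈ cell T ∩ Ω, ‖v x‖ₑ ^ p ≤
        ENNReal.ofReal (K / 𝒯.size ^ n) * ∫⁻ y in interior (cell T) ∩ Ω, ‖v y‖ₑ ^ p) ∧
      ∀ x ∈ cell T ∩ Ω, ∀ y ∈ cell T ∩ Ω, ‖v x - v y‖ₑ ^ p ≤
        ENNReal.ofReal (K / 𝒯.size ^ n * (‖x - y‖ / 𝒯.size) ^ p) *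
          ∫⁻ y in interior (cell T) ∩ Ω, ‖v y‖ₑ ^ p := by
  -- Shape regularity `h ≤ σ * (2 * r)` says that the inscribed radius is at least `h / (2 * σ)`.
  obtain ⟨K, hK, H⟩ := exists_inverse_estimate n m (ρ := 1 / (2 * σ)) (by positivity) hp
  refine ⟨K, hK, fun Ω hΩ hnull 𝒯 hh hreg v hv T hT => ?_⟩
  obtain ⟨c, r, hr, hball, hsize⟩ := hreg T hT
  obtain ⟨q, hq, hvq⟩ := hv.eq_polynomial T hT
  have hsub := 𝒯.cell_subset_closedBall hT (hball (Metric.mem_ball_self hr))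
  obtain ⟨H1, H2⟩ := H q hq c 𝒯.size r hh (by
    rw [one_div_mul_eq_div, div_le_iff₀ (by positivity)]; linarith)
  have hint : ∫⁻ y in Metric.ball c r, ‖polyFun q y‖ₑ ^ p ≤
      ∫⁻ y in interior (cell T) ∩ Ω, ‖v y‖ₑ ^ p := by
    -- `v` is polynomial only on the part of the cell inside `Ω`; the cell lies in the closure of
    -- `Ω`, so what is lost lies in the null frontier.
    have h1 : (Metric.ball c r ∩ Ω : Set _) =ᵐ[volume] Metric.ball c r := by
      refine Filter.EventuallyLE.antisymm (Set.inter_subset_left.eventuallyLE) ?_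
      rw [ae_le_set]
      refine measure_mono_null (fun x hx => ?_) hnull
      exact ⟨𝒯.cell_subset_closure hT (hball hx.1),
        fun hx' => hx.2 ⟨hx.1, interior_subset hx'⟩⟩
    rw [← setLIntegral_congr h1]
    calc ∫⁻ y in Metric.ball c r ∩ Ω, ‖polyFun q y‖ₑ ^ p
        = ∫⁻ y in Metric.ball c r ∩ Ω, ‖v y‖ₑ ^ p :=
          setLIntegral_congr_fun (Metric.isOpen_ball.measurableSet.inter hΩ) fun y hy => by
            simp only [hvq y ⟨hball hy.1, hy.2⟩, polyFun]
      _ ≤ _ := lintegral_mono_set (Set.inter_subset_inter_left _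
          (interior_maximal hball Metric.isOpen_ball))
  refine ⟨fun x hx => ?_, fun x hx y hy => ?_⟩
  · rw [hvq x hx]
    exact (H1 x (hsub hx.1)).trans (by gcongr)
  · rw [hvq x hx, hvq y hy]
    exact (H2 x (hsub hx.1) y (hsub hy.1)).trans (by gcongr)

/-- A cell of a shape-regular mesh and its translate by `z` differ by a set whose relative volume is
of order `‖z‖ / h`. -/
lemma IsShapeRegular.volume_cell_diff_translate_le {𝒯 : Mesh Ω} {σ : ℝ}
    (hreg : 𝒯.IsShapeRegular σ) (hh : 0 < 𝒯.size)
    {T : Affine.Simplex ℝ (EuclideanSpace ℝ (Fin n)) n} (hT : T ∈ 𝒯.cells)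
    (z : EuclideanSpace ℝ (Fin n)) :
    volume (cell T \ {x | x + z ∈ cell T}) ≤
      ENNReal.ofReal (n * (4 * σ) * (‖z‖ / 𝒯.size)) * volume (cell T) := by
  obtain ⟨c, r, hr, hball, hsize⟩ := hreg T hT
  refine (volume_diff_translate_le (convex_cell T) (measurableSet_cell T)
    (isCompact_cell T).measure_lt_top.ne hr hball z).trans ?_
  gcongr ENNReal.ofReal ?_ * _
  rw [mul_assoc]
  gcongr
  rw [← mul_div_assoc, div_le_div_iff₀ hr hh]
  nlinarith [mul_le_mul_of_nonneg_left hsize (norm_nonneg z)]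

/-! ### The `L^p` modulus of continuity. -/

lemma enorm_sub_rpow_le (a b : ℝ) {p : ℝ} (hp : 1 ≤ p) :
    ‖a - b‖ₑ ^ p ≤ 2 ^ (p - 1) * (‖a‖ₑ ^ p + ‖b‖ₑ ^ p) :=
  (ENNReal.rpow_le_rpow enorm_sub_le (by linarith)).trans
    (ENNReal.rpow_add_le_mul_rpow_add_rpow _ _ hp)

/-- The `L^p` modulus of continuity of a piecewise polynomial on a shape-regular mesh. -/
lemma exists_lintegral_translate_sub_le (n m : ℕ) {σ p : ℝ} (hσ : 0 < σ) (hp : 1 ≤ p) :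
    ∃ C : ℝ, 0 ≤ C ∧ ∀ Ω : Set (EuclideanSpace ℝ (Fin n)), MeasurableSet Ω →
      volume (frontier Ω) = 0 →
      ∀ 𝒯 : Mesh Ω, 0 < 𝒯.size → 𝒯.IsShapeRegular σ →
      ∀ v, Measurable v → 𝒯.IsPiecewisePolynomial m v → ∀ z : EuclideanSpace ℝ (Fin n),
      ∫⁻ y in Ω ∩ {y | y + z ∈ Ω}, ‖v (y + z) - v y‖ₑ ^ p ≤
        ENNReal.ofReal (C * min 1 (‖z‖ / 𝒯.size)) * ∫⁻ y in Ω, ‖v y‖ₑ ^ p := by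
  obtain ⟨K, hK, H⟩ := exists_cell_estimate n m hσ hp
  set ω := volume.real (Metric.ball (0 : EuclideanSpace ℝ (Fin n)) 1) with hω
  have hω0 : 0 ≤ ω := measureReal_nonneg
  set D : ℝ := 2 ^ (p - 1) with hD
  have hD0 : 0 ≤ D := by positivity
  have hDE : (2 : ℝ≥0∞) ^ (p - 1) = ENNReal.ofReal D := by
    rw [hD, ← ENNReal.ofReal_rpow_of_pos two_pos]; simp
  -- The `1` comes from pairs in a common cell, the other term from the two boundary layers of a
  -- cell; `ω * h ^ n` bounds the volume of a cell and cancels the `h ^ n` of the inverse estimates.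
  set C1 : ℝ := K * ω * (1 + 2 * D * (n * (4 * σ))) with hC1
  have hC10 : 0 ≤ C1 := by positivity
  refine ⟨max (2 * D) C1, le_max_of_le_right hC10, fun Ω hΩ hnull 𝒯 hh hreg v hvm hv z => ?_⟩
  set h := 𝒯.size with hh'
  set N := ∫⁻ y in Ω, ‖v y‖ₑ ^ p with hN
  have hS : MeasurableSet (Ω ∩ {y | y + z ∈ Ω}) :=
    hΩ.inter (hΩ.preimage (measurable_add_const z))
  rcases le_or_gt h ‖z‖ with hz | hz
  · rw [min_eq_left ((one_le_div hh).2 hz), mul_one]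
    set W : EuclideanSpace ℝ (Fin n) → ℝ≥0∞ := Ω.indicator fun y => ‖v y‖ₑ ^ p with hW
    have hWm : Measurable W := (hvm.enorm.pow_const p).indicator hΩ
    have hWN : ∫⁻ y, W y = N := lintegral_indicator hΩ _
    calc ∫⁻ y in Ω ∩ {y | y + z ∈ Ω}, ‖v (y + z) - v y‖ₑ ^ p
        ≤ ∫⁻ y in Ω ∩ {y | y + z ∈ Ω}, ENNReal.ofReal D * (W (y + z) + W y) := by
          refine setLIntegral_mono' hS fun y hy => ?_
          simp only [hW]
          rw [Set.indicator_of_mem hy.1, Set.indicator_of_mem (show y + z ∈ Ω from hy.2), ← hDE]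
          exact enorm_sub_rpow_le _ _ hp
      _ ≤ ∫⁻ y, ENNReal.ofReal D * (W (y + z) + W y) := setLIntegral_le_lintegral _ _
      _ = ENNReal.ofReal (2 * D) * N := by
          rw [lintegral_const_mul' _ _ ENNReal.ofReal_ne_top, lintegral_add_right _ hWm,
            lintegral_add_right_eq_self W z, hWN, ← two_mul, mul_comm 2 D,
            ENNReal.ofReal_mul hD0, ENNReal.ofReal_ofNat, mul_assoc]
      _ ≤ _ := by gcongr; exact le_max_left _ _
  · set t := ‖z‖ / h with ht
    have ht0 : 0 ≤ t := by positivity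
    have ht1 : t ≤ 1 := ((div_lt_one hh).2 hz).le
    rw [min_eq_right ht1]
    have htp : t ^ p ≤ t := by simpa using Real.rpow_le_rpow_of_exponent_ge' ht0 ht1 zero_le_one hp
    set I : Affine.Simplex ℝ (EuclideanSpace ℝ (Fin n)) n → ℝ≥0∞ :=
      fun T => ∫⁻ y in interior (cell T) ∩ Ω, ‖v y‖ₑ ^ p with hI
    set A : Affine.Simplex ℝ (EuclideanSpace ℝ (Fin n)) n → ℝ≥0∞ :=
      fun T => ENNReal.ofReal (K / h ^ n * t) * I T with hA
    set M : Affine.Simplex ℝ (EuclideanSpace ℝ (Fin n)) n → ℝ≥0∞ :=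
      fun T => ENNReal.ofReal D * (ENNReal.ofReal (K / h ^ n) * I T) with hM
    have hcell := H Ω hΩ hnull 𝒯 hh hreg v hv
    -- A pointwise majorant, a sum of constants times indicators: `A T` for pairs staying in `T`,
    -- and `M T` for `y` leaving `T` or entering it under translation by `z`.
    let φ : Affine.Simplex ℝ (EuclideanSpace ℝ (Fin n)) n → EuclideanSpace ℝ (Fin n) → ℝ≥0∞ :=
      fun T y => (cell T).indicator (fun _ => A T) y +
        ((cell T \ {y | y + z ∈ cell T}).indicator (fun _ => M T) y +
          ({y | y + z ∈ cell T} \ cell T).indicator (fun _ => M T) y)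
    have hTz : ∀ T : Affine.Simplex ℝ (EuclideanSpace ℝ (Fin n)) n,
        MeasurableSet {y | y + z ∈ cell T} := fun T =>
      (measurableSet_cell T).preimage (measurable_add_const z)
    have hφm : ∀ T, Measurable (φ T) := fun T =>
      (measurable_const.indicator (measurableSet_cell T)).add
        ((measurable_const.indicator ((measurableSet_cell T).diff (hTz T))).add
          (measurable_const.indicator ((hTz T).diff (measurableSet_cell T))))
    have hpt : ∀ y ∈ Ω ∩ {y | y + z ∈ Ω}, ‖v (y + z) - v y‖ₑ ^ p ≤ ∑ T ∈ 𝒯.cells, φ T y := by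
      rintro y ⟨hy, hyz⟩
      have same : ∀ T ∈ 𝒯.cells, y ∈ cell T → y + z ∈ cell T →
          ‖v (y + z) - v y‖ₑ ^ p ≤ ∑ T ∈ 𝒯.cells, φ T y := by
        intro T hT h1 h2
        refine le_trans ?_ (Finset.single_le_sum (f := fun T => φ T y) (fun _ _ => zero_le) hT)
        refine le_trans ?_ le_self_add
        rw [Set.indicator_of_mem h1]
        refine ((hcell T hT).2 _ ⟨h2, hyz⟩ _ ⟨h1, hy⟩).trans ?_
        rw [add_sub_cancel_left]
        simp only [hA]
        gcongr
      obtain ⟨T, hT, hyT⟩ := 𝒯.exists_cell_of_mem hy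
      obtain ⟨T', hT', hyT'⟩ := 𝒯.exists_cell_of_mem hyz
      -- If neither chosen cell contains both points, then `y` leaves `T` and enters `T' ≠ T`, so
      -- two distinct summands absorb `v y` and `v (y + z)`.
      by_cases h1 : y + z ∈ cell T
      · exact same T hT hyT h1
      by_cases h2 : y ∈ cell T'
      · exact same T' hT' h2 hyT'
      have hne : T ≠ T' := fun e => h1 (e ▸ hyT')
      refine le_trans ?_ (Finset.add_le_sum (f := fun T => φ T y) (fun _ _ => zero_le) hT hT' hne)
      have e1 : M T ≤ φ T y := by
        simp only [φ]
        rw [Set.indicator_of_mem (s := cell T \ {y | y + z ∈ cell T}) ⟨hyT, h1⟩]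
        exact le_self_add.trans le_add_self
      have e2 : M T' ≤ φ T' y := by
        simp only [φ]
        rw [Set.indicator_of_mem (s := {y | y + z ∈ cell T'} \ cell T') ⟨hyT', h2⟩]
        exact le_add_self.trans le_add_self
      refine le_trans ?_ (add_le_add e1 e2)
      refine (enorm_sub_rpow_le _ _ hp).trans ?_
      rw [hDE, mul_add, add_comm]
      exact add_le_add (mul_le_mul_right ((hcell T hT).1 y ⟨hyT, hy⟩) _)
        (mul_le_mul_right ((hcell T' hT').1 _ ⟨hyT', hyz⟩) _)
    have hφint : ∀ T ∈ 𝒯.cells, ∫⁻ y, φ T y ≤ ENNReal.ofReal (C1 * t) * I T := by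
      intro T hT
      have hvol := 𝒯.volume_cell_le hh.le hT
      have hd1 := hreg.volume_cell_diff_translate_le hh hT z
      -- The entering layer is a translate of the leaving layer for `-z`.
      have hd2 : volume ({y | y + z ∈ cell T} \ cell T) ≤
          ENNReal.ofReal (n * (4 * σ) * t) * volume (cell T) := by
        have h1 := hreg.volume_cell_diff_translate_le hh hT (-z)
        rw [norm_neg] at h1
        refine le_of_eq_of_le ?_ h1
        rw [← measure_preimage_add_right volume z (cell T \ {x | x + -z ∈ cell T})]
        congr 1
        ext y
        simp
      rw [← hω, ← hh'] at hvol
      set w := n * (4 * σ) * t with hw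
      have hw0 : 0 ≤ w := by positivity
      simp only [φ]
      rw [lintegral_add_left (measurable_const.indicator (measurableSet_cell T)),
        lintegral_add_left (measurable_const.indicator ((measurableSet_cell T).diff (hTz T))),
        lintegral_indicator_const (measurableSet_cell T),
        lintegral_indicator_const ((measurableSet_cell T).diff (hTz T)),
        lintegral_indicator_const ((hTz T).diff (measurableSet_cell T))]
      calc _ ≤ A T * ENNReal.ofReal (h ^ n * ω) +
            (M T * (ENNReal.ofReal w * ENNReal.ofReal (h ^ n * ω)) +
              M T * (ENNReal.ofReal w * ENNReal.ofReal (h ^ n * ω))) := by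
            gcongr
            · exact hd1.trans (by gcongr)
            · exact hd2.trans (by gcongr)
        _ = (ENNReal.ofReal (K / h ^ n * t) * ENNReal.ofReal (h ^ n * ω) +
            (ENNReal.ofReal D * ENNReal.ofReal (K / h ^ n) *
              (ENNReal.ofReal w * ENNReal.ofReal (h ^ n * ω)) +
            ENNReal.ofReal D * ENNReal.ofReal (K / h ^ n) *
              (ENNReal.ofReal w * ENNReal.ofReal (h ^ n * ω)))) * I T := by
            simp only [hA, hM]; ring
        _ = ENNReal.ofReal (C1 * t) * I T := by
            have hKh : 0 ≤ K / h ^ n := by positivity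
            have hhω : 0 ≤ h ^ n * ω := by positivity
            rw [← ENNReal.ofReal_mul (by positivity), ← ENNReal.ofReal_mul hD0,
              ← ENNReal.ofReal_mul hw0, ← ENNReal.ofReal_mul (by positivity),
              ← ENNReal.ofReal_add (by positivity) (by positivity),
              ← ENNReal.ofReal_add (by positivity) (by positivity)]
            congr 2
            rw [hC1, hw]
            field_simp
            ring
    calc ∫⁻ y in Ω ∩ {y | y + z ∈ Ω}, ‖v (y + z) - v y‖ₑ ^ p
        ≤ ∫⁻ y in Ω ∩ {y | y + z ∈ Ω}, ∑ T ∈ 𝒯.cells, φ T y := setLIntegral_mono' hS hpt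
      _ ≤ ∫⁻ y, ∑ T ∈ 𝒯.cells, φ T y := setLIntegral_le_lintegral _ _
      _ = ∑ T ∈ 𝒯.cells, ∫⁻ y, φ T y := lintegral_finsetSum _ fun T _ => hφm T
      _ ≤ ∑ T ∈ 𝒯.cells, ENNReal.ofReal (C1 * t) * I T := Finset.sum_le_sum hφint
      _ = ENNReal.ofReal (C1 * t) * ∑ T ∈ 𝒯.cells, I T := by rw [Finset.mul_sum]
      _ ≤ ENNReal.ofReal (max (2 * D) C1 * t) * N := by
          gcongr
          · exact le_max_right _ _
          · exact 𝒯.sum_setLIntegral_interior_cell_le hΩ _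

end Mesh

/-! ### From translation moduli to the seminorm. -/

/-- The Gagliardo double integral as a superposition of translation moduli. -/
lemma lintegral_gagliardo_eq (hΩ : MeasurableSet Ω) {v : EuclideanSpace ℝ (Fin n) → ℝ}
    (hv : Measurable v) {p : ℝ} (hp : 0 ≤ p) (b : ℝ) :
    ∫⁻ y in Ω, ∫⁻ x in Ω, ENNReal.ofReal (|v x - v y| ^ p / ‖x - y‖ ^ b) =
      ∫⁻ z, ENNReal.ofReal (1 / ‖z‖ ^ b) *
        ∫⁻ y in Ω ∩ {y | y + z ∈ Ω}, ‖v (y + z) - v y‖ₑ ^ p := by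
  let F : EuclideanSpace ℝ (Fin n) → EuclideanSpace ℝ (Fin n) → ℝ≥0∞ := fun y z =>
    ENNReal.ofReal (1 / ‖z‖ ^ b) * ‖v (y + z) - v y‖ₑ ^ p
  have hpt : ∀ y z, ENNReal.ofReal (|v (y + z) - v y| ^ p / ‖y + z - y‖ ^ b) = F y z := by
    intro y z
    simp only [F]
    rw [add_sub_cancel_left, div_eq_mul_one_div, mul_comm, ENNReal.ofReal_mul (by positivity),
      ← ENNReal.ofReal_rpow_of_nonneg (abs_nonneg _) hp, Real.enorm_eq_ofReal_abs]
  have hSz : ∀ z, MeasurableSet (Ω ∩ {y | y + z ∈ Ω}) := fun z =>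
    hΩ.inter (hΩ.preimage (measurable_add_const z))
  have hprod : MeasurableSet {w : EuclideanSpace ℝ (Fin n) × EuclideanSpace ℝ (Fin n) |
      w.1 ∈ Ω ∧ w.1 + w.2 ∈ Ω} :=
    (hΩ.preimage measurable_fst).inter (hΩ.preimage (measurable_fst.add measurable_snd))
  have hFm : Measurable (Function.uncurry F) := by
    have h1 : Measurable fun w : EuclideanSpace ℝ (Fin n) × EuclideanSpace ℝ (Fin n) =>
        ‖v (w.1 + w.2) - v w.1‖ₑ ^ p :=
      ((hv.comp (measurable_fst.add measurable_snd)).sub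
        (hv.comp measurable_fst)).enorm.pow_const p
    have h2 : Measurable fun w : EuclideanSpace ℝ (Fin n) × EuclideanSpace ℝ (Fin n) =>
        ENNReal.ofReal (1 / ‖w.2‖ ^ b) := by fun_prop
    exact h2.mul h1
  -- Both domain constraints go into one indicator on the product space, so that Tonelli applies on
  -- the whole space.
  have hleft : ∀ y, Ω.indicator (fun y => ∫⁻ x in Ω,
      ENNReal.ofReal (|v x - v y| ^ p / ‖x - y‖ ^ b)) y =
      ∫⁻ z, {w : EuclideanSpace ℝ (Fin n) × EuclideanSpace ℝ (Fin n) |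
        w.1 ∈ Ω ∧ w.1 + w.2 ∈ Ω}.indicator (Function.uncurry F) (y, z) := by
    intro y
    by_cases hy : y ∈ Ω
    · rw [Set.indicator_of_mem hy, ← lintegral_indicator hΩ,
        ← lintegral_add_left_eq_self _ y]
      refine lintegral_congr fun z => ?_
      by_cases hz : y + z ∈ Ω
      · rw [Set.indicator_of_mem hz, Set.indicator_of_mem (by exact ⟨hy, hz⟩)]
        exact hpt y z
      · rw [Set.indicator_of_notMem hz, Set.indicator_of_notMem fun h => hz h.2]
    · rw [Set.indicator_of_notMem hy]
      refine ((lintegral_congr fun z => ?_).trans lintegral_zero).symm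
      exact Set.indicator_of_notMem (fun h => hy h.1) _
  rw [← lintegral_indicator hΩ]
  simp_rw [hleft]
  rw [lintegral_lintegral_swap (f := fun y z =>
    {w : EuclideanSpace ℝ (Fin n) × EuclideanSpace ℝ (Fin n) |
      w.1 ∈ Ω ∧ w.1 + w.2 ∈ Ω}.indicator (Function.uncurry F) (y, z))
    (hFm.indicator hprod).aemeasurable]
  refine lintegral_congr fun z => ?_
  rw [← lintegral_const_mul' _ _ ENNReal.ofReal_ne_top, ← lintegral_indicator (hSz z)]
  rfl

/-- The fractional inverse inequality for measurable piecewise polynomials. -/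
lemma exists_gagliardoSeminorm_le_of_measurable (n m : ℕ) (hn : 1 ≤ n) {σ s p : ℝ} (hσ : 0 < σ)
    (hs0 : 0 < s) (hp : 1 ≤ p) (hsp : s * p < 1) :
    ∃ C : ℝ, 0 ≤ C ∧ ∀ Ω : Set (EuclideanSpace ℝ (Fin n)), MeasurableSet Ω →
      volume (frontier Ω) = 0 →
      ∀ 𝒯 : Mesh Ω, 0 < 𝒯.size → 𝒯.IsShapeRegular σ →
      ∀ v, Measurable v → 𝒯.IsPiecewisePolynomial m v →
      gagliardoSeminorm Ω s p v ≤ ENNReal.ofReal (C * 𝒯.size ^ (-s)) *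
        eLpNorm v (ENNReal.ofReal p) (volume.restrict Ω) := by
  have hp0 : 0 < p := by linarith
  obtain ⟨C, hC, H⟩ := Mesh.exists_lintegral_translate_sub_le n m hσ hp
  obtain ⟨M, hM, hker⟩ := exists_lintegral_kernel_le n hn (mul_pos hs0 hp0) hsp
  refine ⟨(C * M) ^ (1 / p), by positivity, fun Ω hΩ hnull 𝒯 hh hreg v hvm hv => ?_⟩
  rw [gagliardoSeminorm, eLpNorm_eq_lintegral_rpow_enorm_toReal (by simpa using hp0) (by simp),
    ENNReal.toReal_ofReal hp0.le, lintegral_gagliardo_eq hΩ hvm hp0.le]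
  set h := 𝒯.size
  set N := ∫⁻ y in Ω, ‖v y‖ₑ ^ p
  have key : ∫⁻ z, ENNReal.ofReal (1 / ‖z‖ ^ ((n : ℝ) + s * p)) *
      ∫⁻ y in Ω ∩ {y | y + z ∈ Ω}, ‖v (y + z) - v y‖ₑ ^ p ≤
        ENNReal.ofReal (C * M * h ^ (-(s * p))) * N := by
    calc _ ≤ ∫⁻ z : EuclideanSpace ℝ (Fin n), ENNReal.ofReal C *
          ENNReal.ofReal (1 / ‖z‖ ^ ((n : ℝ) + s * p) * min 1 (‖z‖ / h)) * N := by
          refine lintegral_mono fun z => ?_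
          have hmin : 0 ≤ min 1 (‖z‖ / h) := le_min zero_le_one (by positivity)
          refine (mul_le_mul_right (H Ω hΩ hnull 𝒯 hh hreg v hvm hv z) _).trans (le_of_eq ?_)
          rw [ENNReal.ofReal_mul hC, ENNReal.ofReal_mul (by positivity)]
          ring
      _ = ENNReal.ofReal C * (∫⁻ z : EuclideanSpace ℝ (Fin n),
          ENNReal.ofReal (1 / ‖z‖ ^ ((n : ℝ) + s * p) * min 1 (‖z‖ / h))) * N := by
          rw [lintegral_mul_const _ (by fun_prop), lintegral_const_mul _ (by fun_prop)]
      _ ≤ ENNReal.ofReal C * ENNReal.ofReal (M * h ^ (-(s * p))) * N := by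
          gcongr
          exact hker h hh
      _ = _ := by rw [← ENNReal.ofReal_mul hC, mul_assoc]
  refine (ENNReal.rpow_le_rpow key (by positivity)).trans (le_of_eq ?_)
  rw [ENNReal.mul_rpow_of_nonneg _ _ (by positivity),
    ENNReal.ofReal_rpow_of_nonneg (by positivity) (by positivity),
    Real.mul_rpow (by positivity) (by positivity), ← Real.rpow_mul hh.le]
  congr 4
  field_simp

end FracInverse

end

theorem mainTheorem3 (n : ℕ) (hn : 1 ≤ n) (Ω : Set (EuclideanSpace ℝ (Fin n)))
    (hΩ : FracInverse.IsPolygonalDomain Ω) (σ : ℝ) (m : ℕ) (hm : 1 ≤ m)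
    (s p : ℝ) (hs0 : 0 < s) (hs1 : s < 1) (hp : 1 ≤ p) (hsp : s * p < 1) :
    ∃ C : ℝ, 0 < C ∧ ∀ 𝒯 : FracInverse.Mesh Ω, 𝒯.IsShapeRegular σ →
      ∀ v : EuclideanSpace ℝ (Fin n) → ℝ, 𝒯.IsPiecewisePolynomial m v →
        FracInverse.gagliardoSeminorm Ω s p v ≤
          ENNReal.ofReal (C * 𝒯.size ^ (-s)) *
            eLpNorm v (ENNReal.ofReal p) (volume.restrict Ω) := by
  have hne : Ω.Nonempty := hΩ.isConnected.nonempty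
  have hΩm : MeasurableSet Ω := hΩ.isOpen.measurableSet
  -- For `σ ≤ 0` no mesh is shape-regular, because its size is positive.
  rcases le_or_gt σ 0 with hσ | hσ
  · refine ⟨1, one_pos, fun 𝒯 hreg v _ => ?_⟩
    obtain ⟨x, hx⟩ := hne
    obtain ⟨T, hT, -⟩ := 𝒯.exists_cell_of_mem hx
    obtain ⟨c, r, hr, -, hsize⟩ := hreg T hT
    have := 𝒯.size_pos hn ⟨x, hx⟩
    nlinarith
  obtain ⟨C, hC, H⟩ :=
    FracInverse.exists_gagliardoSeminorm_le_of_measurable n m hn hσ hs0 hp hsp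
  refine ⟨C + 1, by linarith, fun 𝒯 hreg v hv => ?_⟩
  have hh := 𝒯.size_pos hn hne
  -- `v` may be non-measurable outside `Ω`; its extension by zero is measurable, and both sides of
  -- the estimate see only `Ω`.
  have hVv : Set.EqOn (Ω.indicator v) v Ω := fun x hx => Set.indicator_of_mem hx v
  have hVm : Measurable (Ω.indicator v) := by
    classical
    rw [← Set.piecewise_eq_indicator]
    exact hv.continuousOn.measurable_piecewise continuousOn_const hΩm
  have hV : 𝒯.IsPiecewisePolynomial m (Ω.indicator v) := by
    refine ⟨hv.continuousOn.congr hVv, fun T hT => ?_⟩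
    obtain ⟨q, hq, hvq⟩ := hv.eq_polynomial T hT
    exact ⟨q, hq, fun x hx => (hVv hx.2).trans (hvq x hx)⟩
  have hsemi : FracInverse.gagliardoSeminorm Ω s p v =
      FracInverse.gagliardoSeminorm Ω s p (Ω.indicator v) := by
    unfold FracInverse.gagliardoSeminorm
    congr 1
    refine setLIntegral_congr_fun hΩm fun y hy => setLIntegral_congr_fun hΩm fun x hx => ?_
    simp only [hVv hx, hVv hy]
  have hnorm : eLpNorm (Ω.indicator v) (ENNReal.ofReal p) (volume.restrict Ω) =
      eLpNorm v (ENNReal.ofReal p) (volume.restrict Ω) :=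
    eLpNorm_congr_ae ((ae_restrict_mem hΩm).mono fun x hx => hVv hx)
  rw [hsemi, ← hnorm]
  refine (H Ω hΩm hΩ.volume_frontier 𝒯 hh hreg _ hVm hV).trans ?_
  gcongr
  linarith
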